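/- Let $k$ be a field. Condensed sets are sheaves of sets on the category of (small) profinite sets, for the topology whose coverings are generated by the finite jointly surjective families. Fpqc sheaves over $k$ are sheaves of sets on the opposite of the category of (small) commutative $k$-algebras, for the topology whose coverings are generated by the finite families $(A\to B_i)_i$ with $A\to\prod_i B_i$ faithfully flat. (Here "small" refers to a fixed universe, equivalently to a fixed strongly inaccessible cardinal $\kappa$; $k$ is assumed small, and sheaves take values in sets of the next larger universe.) Let $f_*$ be the functor sending an fpqc sheaf $\mathcal X$ over $k$ to the condensed set $S\mapsto \mathcal X(\mathcal C(S,k))$, where $\mathcal C(S,k)$ is the $k$-algebra of continuous functions from $S$ to the discrete field $k$. Let $f^*$ be its left adjoint. For a condensed set $X$, the fpqc sheaf $X_k^{\mathrm{p\acute{e}t}} := f^*(X)$ is called the pétra space of $X$ over $k$. Then there is a bijection, natural in the condensed set $X$, $$X(*)\;\simeq\; X_k^{\mathrm{p\acute{e}t}}(k)$$ between the underlying set of $X$ and the set of $k$-points of its pétra space. It is the composite of the map $X(*)\to (f_*f^*X)(*) = X_k^{\mathrm{p\acute{e}t}}(\mathcal C(*,k))$ given by the unit of the adjunction $f^*\dashv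 f_*$ with the bijection induced by the evaluation isomorphism $\mathcal C(*,k)\cong k$. -/

import Mathlib

open CategoryTheory Opposite TensorProduct

universe u

namespace Petra

/-! ### The fpqc topology on the opposite of the category of commutative `k`-algebras -/

/-- The `k`-algebra maps `f i : A ⟶ B i` are flat and jointly surjective on prime spectra.
For a finite index type this says exactly that `A → ∏ i, B i` is faithfully flat. -/
structure IsFpqcFamily {k : Type u} [CommRing k] {A : CommAlgCat.{u} k} {ι : Type}
    (B : ι → CommAlgCat.{u} k) (f : ∀ i, A ⟶ B i) : Prop where
  flat : ∀ i, (f i).hom.toRingHom.Flat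
  surj : ∀ p : PrimeSpectrum A, ∃ i, ∃ q : PrimeSpectrum (B i),
    PrimeSpectrum.comap (f i).hom.toRingHom q = p

/-- Joint surjectivity on spectra is stable under base change. -/
lemma exists_comap_includeLeft {A B C : Type u} [CommRing A] [CommRing B] [CommRing C]
    [Algebra A B] [Algebra A C] (p : PrimeSpectrum B) (q : PrimeSpectrum C)
    (h : PrimeSpectrum.comap (algebraMap A C) q = PrimeSpectrum.comap (algebraMap A B) p) :
    ∃ r : PrimeSpectrum (B ⊗[A] C),
      PrimeSpectrum.comap (algebraMap B (B ⊗[A] C)) r = p := by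
  have h1 : PrimeSpectrum.comap (algebraMap A B) p ∈
      Set.range (PrimeSpectrum.comap (algebraMap A C)) := ⟨q, h⟩
  rw [← PrimeSpectrum.nontrivial_iff_mem_rangeComap] at h1
  change p ∈ Set.range _
  rw [← PrimeSpectrum.nontrivial_iff_mem_rangeComap]
  let P : Ideal A := p.asIdeal.comap (algebraMap A B)
  let : Algebra P.ResidueField p.asIdeal.ResidueField :=
    (Ideal.ResidueField.mapₐ P p.asIdeal (Algebra.ofId A B) rfl).toRingHom.toAlgebra
  have : IsScalarTower A P.ResidueField p.asIdeal.ResidueField :=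
    IsScalarTower.of_algebraMap_eq fun x ↦
      ((Ideal.ResidueField.mapₐ P p.asIdeal (Algebra.ofId A B) rfl).commutes x).symm
  let e1 := Algebra.TensorProduct.cancelBaseChange A B B p.asIdeal.ResidueField C
  let e2 := Algebra.TensorProduct.cancelBaseChange A P.ResidueField P.ResidueField
    p.asIdeal.ResidueField C
  have : Nontrivial (P.ResidueField ⊗[A] C) := h1
  exact (e1.toEquiv.trans e2.symm.toEquiv).nontrivial

/-- The fpqc topology on `(CommAlgCat k)ᵒᵖ`: a sieve is covering if it contains a finite family
of flat, jointly surjective (on spectra) maps. -/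
def fpqcTopology (k : Type u) [CommRing k] : GrothendieckTopology (CommAlgCat.{u} k)ᵒᵖ where
  sieves A := {S | ∃ (ι : Type) (_ : Finite ι) (B : ι → CommAlgCat.{u} k)
    (f : ∀ i, A.unop ⟶ B i), IsFpqcFamily B f ∧ ∀ i, S (f i).op}
  top_mem' A := ⟨Unit, inferInstance, fun _ ↦ A.unop, fun _ ↦ 𝟙 _,
    ⟨fun _ ↦ RingHom.Flat.id _, fun p ↦ ⟨(), p, rfl⟩⟩, fun _ ↦ trivial⟩
  pullback_stable' := by
    rintro A A' S g ⟨ι, hι, B, f, hf, hS⟩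
    let : Algebra A.unop A'.unop := g.unop.hom.toRingHom.toAlgebra
    let (i : ι) : Algebra A.unop (B i) := (f i).hom.toRingHom.toAlgebra
    have : IsScalarTower k A.unop A'.unop :=
      IsScalarTower.of_algebraMap_eq fun x ↦ (g.unop.hom.commutes x).symm
    have (i : ι) : IsScalarTower k A.unop (B i) :=
      IsScalarTower.of_algebraMap_eq fun x ↦ ((f i).hom.commutes x).symm
    refine ⟨ι, hι, fun i ↦ CommAlgCat.of k (A'.unop ⊗[A.unop] B i), fun i ↦
      CommAlgCat.ofHom (IsScalarTower.toAlgHom k A'.unop (A'.unop ⊗[A.unop] B i)),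
      ⟨fun i ↦ ?_, fun p ↦ ?_⟩, fun i ↦ ?_⟩
    · have : Module.Flat A.unop (B i) := hf.flat i
      change (algebraMap A'.unop (A'.unop ⊗[A.unop] B i)).Flat
      rw [RingHom.flat_algebraMap_iff]
      infer_instance
    · obtain ⟨i, q, hq⟩ := hf.surj (PrimeSpectrum.comap (algebraMap A.unop A'.unop) p)
      exact ⟨i, exists_comap_includeLeft p q hq⟩
    · have h : (CommAlgCat.ofHom
          (IsScalarTower.toAlgHom k A'.unop (A'.unop ⊗[A.unop] B i))).op ≫ g =
          (CommAlgCat.ofHom ((Algebra.TensorProduct.includeRight :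
            B i →ₐ[A.unop] A'.unop ⊗[A.unop] B i).restrictScalars k)).op ≫ (f i).op := by
        apply Quiver.Hom.unop_inj
        apply CommAlgCat.hom_ext
        ext x
        exact Algebra.TensorProduct.tmul_one_eq_one_tmul (A := A'.unop) (B := B i) x
      change S _
      rw [h]
      exact S.downward_closed (hS i) _
  transitive' := by
    rintro A S ⟨ι, hι, B, f, hf, hS⟩ R hR
    choose κ hκ C g hg hRg using fun i ↦ hR (hS i)
    refine ⟨Σ i, κ i, inferInstance, fun j ↦ C j.1 j.2, fun j ↦ f j.1 ≫ g j.1 j.2,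
      ⟨fun j ↦ (hf.flat j.1).comp ((hg j.1).flat j.2), fun p ↦ ?_⟩, fun j ↦ hRg j.1 j.2⟩
    obtain ⟨i, q, rfl⟩ := hf.surj p
    obtain ⟨j, r, rfl⟩ := (hg i).surj q
    exact ⟨⟨i, j⟩, r, rfl⟩

/-! ### The algebra of continuous functions on a profinite set -/

/-- The functor `S ↦ C(S, k)` from profinite sets to the opposite of `k`-algebras, where `k` is
discrete (so that continuous functions to `k` are the same as locally constant ones). It is the
composite of Stone duality between profinite sets and Stone `k`-algebras with the inclusion of
Stone `k`-algebras into all `k`-algebras. -/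
noncomputable def functions (k : Type u) [CommRing k] :
    Profinite.{u} ⥤ (CommAlgCat.{u} k)ᵒᵖ where
  obj S := op (CommAlgCat.of k (LocallyConstant S k))
  map f := (CommAlgCat.ofHom (LocallyConstant.comapₐ k f.hom.hom)).op
  map_id _ := rfl
  map_comp _ _ := rfl

section

variable {k : Type u} [Field k] {S : Type u} [TopologicalSpace S]

open scoped Classical in
/-- The indicator function of the zero locus of a locally constant function. -/
noncomputable def zeroIndicator (f : LocallyConstant S k) : LocallyConstant S k :=
  LocallyConstant.map (fun c ↦ if c = 0 then 1 else 0) f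

lemma zeroIndicator_mul (f : LocallyConstant S k) : f * zeroIndicator f = 0 := by
  ext s
  by_cases h : f s = 0 <;> simp [zeroIndicator, h]

lemma zeroIndicator_add (f : LocallyConstant S k) : zeroIndicator f + f⁻¹ * f = 1 := by
  ext s
  by_cases h : f s = 0 <;> simp [zeroIndicator, h]

lemma zeroIndicator_notMem {f : LocallyConstant S k} {P : Ideal (LocallyConstant S k)}
    [P.IsPrime] (h : f ∈ P) : zeroIndicator f ∉ P := fun h' ↦
  (‹P.IsPrime›).ne_top ((Ideal.eq_top_iff_one P).2
    (zeroIndicator_add f ▸ P.add_mem h' (P.mul_mem_left _ h)))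

/-- Every prime ideal of `C(S, k)` consists of the functions vanishing at some point. -/
lemma exists_point [CompactSpace S] (P : Ideal (LocallyConstant S k)) [P.IsPrime] :
    ∃ s : S, ∀ f, f ∈ P ↔ f s = 0 := by
  have key : ∃ s : S, ∀ f ∈ P, f s = 0 := by
    by_contra! H
    choose f hf hne using H
    obtain ⟨t, ht⟩ := isCompact_univ.elim_finite_subcover (fun s ↦ {x | f s x ≠ 0})
      (fun s ↦ (f s).isLocallyConstant {c | c ≠ 0}) (fun s _ ↦ Set.mem_iUnion.2 ⟨s, hne s⟩)
    have h0 : ∏ s ∈ t, zeroIndicator (f s) = 0 := by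
      ext x
      obtain ⟨s, hs, hx⟩ := Set.mem_iUnion₂.1 (ht (Set.mem_univ x))
      change LocallyConstant.evalₐ k x (∏ s ∈ t, zeroIndicator (f s)) = 0
      rw [map_prod]
      refine Finset.prod_eq_zero hs ?_
      have hx' : f s x ≠ 0 := hx
      simp [zeroIndicator, hx']
    have h1 := (Ideal.IsPrime.prod_mem_iff (p := P)).1 (h0 ▸ P.zero_mem)
    obtain ⟨s, -, hs⟩ := h1
    exact zeroIndicator_notMem (hf s) hs
  obtain ⟨s, hs⟩ := key
  refine ⟨s, fun f ↦ ⟨hs f, fun h ↦ ?_⟩⟩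
  have h1 : f * zeroIndicator f ∈ P := zeroIndicator_mul f ▸ P.zero_mem
  refine ((‹P.IsPrime›).mem_or_mem h1).resolve_right fun h2 ↦ ?_
  have := hs _ h2
  simp [zeroIndicator, h] at this

lemma isField_localization (P : Ideal (LocallyConstant S k)) [P.IsPrime] :
    IsField (Localization.AtPrime P) := by
  rw [IsLocalRing.isField_iff_maximalIdeal_eq, eq_bot_iff]
  rw [← Localization.AtPrime.map_eq_maximalIdeal, Ideal.map_le_iff_le_comap]
  intro f hf
  rw [Ideal.mem_comap, Ideal.mem_bot, IsLocalization.map_eq_zero_iff P.primeCompl]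
  exact ⟨⟨_, zeroIndicator_notMem hf⟩, by rw [mul_comm]; exact zeroIndicator_mul f⟩

/-- Every `C(S, k)`-module is flat. -/
lemma flat_of_locallyConstant (M : Type u) [AddCommGroup M] [Module (LocallyConstant S k) M] :
    Module.Flat (LocallyConstant S k) M := by
  apply Module.flat_of_localized_maximal
  intro P hP
  let F := (isField_localization P).toField
  have : Module.Flat (Localization.AtPrime P) (LocalizedModule P.primeCompl M) :=
    Module.Flat.of_free (R := Localization.AtPrime P)
  exact (Module.flat_iff_of_isLocalization (Localization.AtPrime P) P.primeCompl _).1 this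

end

/-- A finite jointly surjective family of profinite sets gives an fpqc family of algebras. -/
lemma functions_coverPreserving (k : Type u) [Field k] :
    CoverPreserving (coherentTopology Profinite.{u}) (fpqcTopology k) (functions k) where
  cover_preserve {S R} hR := by
    obtain ⟨ι, hι, Y, π, h, hR⟩ :=
      (coherentTopology.mem_sieves_iff_hasEffectiveEpiFamily R).1 hR
    have hs := ((Profinite.effectiveEpiFamily_tfae Y π).out 0 2).1 h
    refine ⟨ι, hι, fun i ↦ ((functions k).obj (Y i)).unop, fun i ↦ ((functions k).map (π i)).unop,
      ⟨fun i ↦ ?_, fun p ↦ ?_⟩, fun i ↦ Sieve.image_mem_functorPushforward _ _ (hR i)⟩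
    · exact @flat_of_locallyConstant k _ S _ _ _
        ((LocallyConstant.comapₐ k (π i).hom.hom).toRingHom.toModule)
    · obtain ⟨s, hps⟩ := @exists_point k _ S _ _ p.asIdeal p.2
      obtain ⟨i, y, rfl⟩ := hs s
      let q : PrimeSpectrum (LocallyConstant (Y i) k) :=
        PrimeSpectrum.comap (LocallyConstant.evalₐ k y).toRingHom ⊥
      refine ⟨i, q, ?_⟩
      ext f
      exact (hps f).symm

section

variable {k : Type u} [Field k] {B : Type u} [CommRing B] [Algebra k B]

lemma eq_of_stalks {B : Type u} [CommRing B] {x y : B}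
    (h : ∀ q : PrimeSpectrum B, algebraMap B (Localization.AtPrime q.asIdeal) x =
      algebraMap B (Localization.AtPrime q.asIdeal) y) : x = y :=
  MaximalSpectrum.toPiLocalization_injective B (funext fun m ↦ h ⟨m.asIdeal, m.isMaximal.isPrime⟩)

/-- A locally constant `k`-valued function on `Spec B` comes from an element of `B`. -/
lemma exists_lift (g : LocallyConstant (PrimeSpectrum B) k) :
    ∃ b : B, ∀ q : PrimeSpectrum B, algebraMap B (Localization.AtPrime q.asIdeal) b =
      algebraMap k _ (g q) := by
  have hcl (c : k) : IsClopen {q : PrimeSpectrum B | g q = c} :=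
    g.isLocallyConstant.isClopen_fiber c
  choose e he heq using fun c ↦ PrimeSpectrum.exists_idempotent_basicOpen_eq_of_isClopen (hcl c)
  have hfin : (Set.range g).Finite := g.range_finite
  refine ⟨∑ c ∈ hfin.toFinset, c • e c, fun q ↦ ?_⟩
  rw [map_sum, Finset.sum_eq_single (g q)]
  · have hq : e (g q) ∉ q.asIdeal := by
      have : q ∈ {q' | g q' = g q} := rfl
      rw [heq] at this
      exact this
    have h1 : IsUnit (algebraMap B (Localization.AtPrime q.asIdeal) (e (g q))) :=
      IsLocalization.map_units (M := q.asIdeal.primeCompl) _ ⟨_, hq⟩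
    have h2 : algebraMap B (Localization.AtPrime q.asIdeal) (e (g q)) = 1 :=
      h1.mul_left_cancel (by rw [← map_mul, (he (g q)).eq, mul_one])
    rw [Algebra.smul_def, map_mul, h2, mul_one, ← IsScalarTower.algebraMap_apply]
  · intro c _ hc
    have hq : 1 - e c ∉ q.asIdeal := fun h ↦ by
      have h3 : q ∉ {q' | g q' = c} := fun h ↦ hc h.symm
      rw [heq] at h3
      have h4 : e c ∈ q.asIdeal := by
        by_contra h5
        exact h3 h5
      exact q.2.ne_top ((Ideal.eq_top_iff_one _).2 (by simpa using add_mem h h4))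
    rw [IsLocalization.map_eq_zero_iff q.asIdeal.primeCompl]
    refine ⟨⟨_, hq⟩, ?_⟩
    change (1 - e c) * (c • e c) = 0
    rw [mul_smul_comm, sub_mul, one_mul, (he c).eq, sub_self, smul_zero]
  · intro h
    exact absurd (hfin.mem_toFinset.2 ⟨q, rfl⟩) h

variable {Y : Type u} [TopologicalSpace Y] [CompactSpace Y]

lemma exists_specPoint (φ : LocallyConstant Y k →ₐ[k] B) (q : PrimeSpectrum B) :
    ∃ y : Y, ∀ f, φ f ∈ q.asIdeal ↔ f y = 0 :=
  exists_point (q.asIdeal.comap φ)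

/-- The point of `Y` given by a prime of `B` and a `k`-algebra map `C(Y, k) → B`. -/
noncomputable def specPoint (φ : LocallyConstant Y k →ₐ[k] B) (q : PrimeSpectrum B) : Y :=
  (exists_specPoint φ q).choose

lemma mem_iff_specPoint (φ : LocallyConstant Y k →ₐ[k] B) (q : PrimeSpectrum B) :
    ∀ f, φ f ∈ q.asIdeal ↔ f (specPoint φ q) = 0 :=
  (exists_specPoint φ q).choose_spec

lemma algebraMap_eq_specPoint (φ : LocallyConstant Y k →ₐ[k] B) (q : PrimeSpectrum B)
    (f : LocallyConstant Y k) : algebraMap B (Localization.AtPrime q.asIdeal) (φ f) =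
      algebraMap k _ (f (specPoint φ q)) := by
  let c := f (specPoint φ q)
  let g := f - algebraMap k _ c
  have hg : g (specPoint φ q) = 0 := sub_self _
  have h0 : algebraMap B (Localization.AtPrime q.asIdeal) (φ g) = 0 := by
    rw [IsLocalization.map_eq_zero_iff q.asIdeal.primeCompl]
    refine ⟨⟨φ (zeroIndicator g), fun h ↦ ?_⟩, ?_⟩
    · rw [SetLike.mem_coe, mem_iff_specPoint] at h
      simp [zeroIndicator, hg] at h
    · change φ (zeroIndicator g) * φ g = 0
      rw [← map_mul, mul_comm, zeroIndicator_mul, map_zero]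
  rw [map_sub, map_sub, sub_eq_zero, AlgHom.commutes] at h0
  rw [h0, ← IsScalarTower.algebraMap_apply]

variable [T2Space Y] [TotallyDisconnectedSpace Y]

lemma continuous_specPoint (φ : LocallyConstant Y k →ₐ[k] B) : Continuous (specPoint φ) := by
  rw [(isTopologicalBasis_isClopen (X := Y)).continuous_iff]
  intro U hU
  have h : specPoint φ ⁻¹' U = PrimeSpectrum.basicOpen (φ (LocallyConstant.charFn k hU)) := by
    ext q
    change _ ↔ φ _ ∉ q.asIdeal
    rw [mem_iff_specPoint, LocallyConstant.charFn_eq_zero, not_not]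
    rfl
  rw [h]
  exact (PrimeSpectrum.basicOpen _).isOpen

/-- A continuous map `Spec B → W` induces a `k`-algebra map `C(W, k) → B`. -/
lemma exists_algHom {W : Type u} [TopologicalSpace W] (a : C(PrimeSpectrum B, W)) :
    ∃ ψ : LocallyConstant W k →ₐ[k] B, ∀ g q,
      algebraMap B (Localization.AtPrime q.asIdeal) (ψ g) = algebraMap k _ (g (a q)) := by
  choose b hb using fun g : LocallyConstant W k ↦ exists_lift (B := B) (g.comap a)
  refine ⟨AlgHom.mk (RingHom.mk (MonoidHom.mk (OneHom.mk b ?_) fun x y ↦ ?_) ?_ fun x y ↦ ?_)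
    fun c ↦ ?_, hb⟩
  all_goals refine eq_of_stalks fun q ↦ ?_
  · rw [hb, map_one]
    exact map_one _
  · rw [map_mul, hb, hb, hb, ← map_mul]
    rfl
  · rw [hb, map_zero]
    exact map_zero _
  · rw [map_add, hb, hb, hb, ← map_add]
    rfl
  · rw [hb, ← IsScalarTower.algebraMap_apply]
    rfl

end

/-- Two maps `C(Y₁, k) → B ← C(Y₂, k)` which agree on `C(Z, k)` factor through the algebra of
functions on the fibre product. -/
lemma exists_factorization {k : Type u} [Field k] {B : CommAlgCat.{u} k} {Z Y₁ Y₂ : Profinite.{u}}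
    (f₁ : op B ⟶ (functions k).obj Y₁) (f₂ : op B ⟶ (functions k).obj Y₂)
    (g₁ : Y₁ ⟶ Z) (g₂ : Y₂ ⟶ Z)
    (h : f₁ ≫ (functions k).map g₁ = f₂ ≫ (functions k).map g₂) :
    ∃ (W : Profinite.{u}) (p₁ : W ⟶ Y₁) (p₂ : W ⟶ Y₂) (f : op B ⟶ (functions k).obj W),
      p₁ ≫ g₁ = p₂ ≫ g₂ ∧ f ≫ (functions k).map p₁ = f₁ ∧ f ≫ (functions k).map p₂ = f₂ := by
  let φ₁ : LocallyConstant Y₁ k →ₐ[k] B := f₁.unop.hom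
  let φ₂ : LocallyConstant Y₂ k →ₐ[k] B := f₂.unop.hom
  have hφ (l : LocallyConstant Z k) : φ₁ (l.comap g₁.hom.hom) = φ₂ (l.comap g₂.hom.hom) :=
    congrArg (fun m ↦ m.unop.hom l) h
  let T : Set (Y₁ × Y₂) := {p | g₁ p.1 = g₂ p.2}
  have hT : IsClosed T := isClosed_eq (g₁.hom.hom.continuous.comp continuous_fst)
    (g₂.hom.hom.continuous.comp continuous_snd)
  have : CompactSpace T := isCompact_iff_compactSpace.1 hT.isCompact
  have hmem (q : PrimeSpectrum B) : (specPoint φ₁ q, specPoint φ₂ q) ∈ T := by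
    change g₁ _ = g₂ _
    by_contra hne
    obtain ⟨U, hU, h1, h2⟩ := exists_isClopen_of_totally_separated hne
    let l : LocallyConstant Z k := LocallyConstant.charFn k hU
    have h3 := mem_iff_specPoint φ₁ q (l.comap g₁.hom.hom)
    rw [hφ, mem_iff_specPoint φ₂ q] at h3
    have h4 : l (g₂ (specPoint φ₂ q)) = 0 := (LocallyConstant.charFn_eq_zero k _ hU).2 h2
    exact (LocallyConstant.charFn_eq_zero k _ hU).1 (h3.1 h4) h1
  let a : C(PrimeSpectrum B, T) := ⟨fun q ↦ ⟨_, hmem q⟩,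
    ((continuous_specPoint φ₁).prodMk (continuous_specPoint φ₂)).subtype_mk _⟩
  obtain ⟨ψ, hψ⟩ := exists_algHom (k := k) a
  refine ⟨Profinite.of T, CompHausLike.ofHom _ ⟨fun t ↦ t.1.1, by fun_prop⟩,
    CompHausLike.ofHom _ ⟨fun t ↦ t.1.2, by fun_prop⟩, (CommAlgCat.ofHom ψ).op, ?_, ?_, ?_⟩
  · ext t
    exact t.2
  · apply Quiver.Hom.unop_inj
    apply CommAlgCat.hom_ext
    refine AlgHom.ext fun l ↦ eq_of_stalks fun q ↦ ?_
    exact (hψ _ q).trans (algebraMap_eq_specPoint φ₁ q l).symm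
  · apply Quiver.Hom.unop_inj
    apply CommAlgCat.hom_ext
    refine AlgHom.ext fun l ↦ eq_of_stalks fun q ↦ ?_
    exact (hψ _ q).trans (algebraMap_eq_specPoint φ₂ q l).symm

instance functions_isContinuous (k : Type u) [Field k] :
    (functions k).IsContinuous (coherentTopology Profinite.{u}) (fpqcTopology k) := by
  refine Functor.isContinuous_of_coverPreserving ⟨?_⟩ (functions_coverPreserving k)
  intro ℱ Z T x hx Y₁ Y₂ B f₁ f₂ g₁ g₂ hg₁ hg₂ h
  obtain ⟨W, p₁, p₂, f, hp, rfl, rfl⟩ := exists_factorization (B := B.unop) f₁ f₂ g₁ g₂ h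
  have := congrArg (ℱ.obj.map f.op) (hx p₁ p₂ hg₁ hg₂ hp)
  simpa using! this

/-! ### Condensed sets, fpqc sheaves and the pétra space

Sizes are handled by universes, as in Mathlib's `CondensedSet`: the universe `u` plays the role of
a strongly inaccessible cardinal `κ`, the sites consist of the profinite sets and `k`-algebras in
`Type u`, and sheaves take values in the sets of the next universe. No accessibility condition is
imposed on sheaves; in particular the accessible ones are included. -/

/-- Condensed sets: sheaves of sets on profinite sets for the topology of finite jointly
surjective families. -/
abbrev Cond : Type (u + 2) :=
  Sheaf (coherentTopology Profinite.{u}) (Type (u + 1))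

/-- fpqc sheaves of sets over `k`. -/
abbrev FpqcSheaf (k : Type u) [CommRing k] : Type (u + 2) :=
  Sheaf (fpqcTopology k) (Type (u + 1))

/-- The functor `f_*` of enhanced `k`-points, sending an fpqc sheaf `𝒳` to the condensed set
`S ↦ 𝒳(C(S, k))`. -/
noncomputable def enhancedPoints (k : Type u) [Field k] : FpqcSheaf k ⥤ Cond.{u} :=
  (functions k).sheafPushforwardContinuous (Type (u + 1))
    (coherentTopology Profinite.{u}) (fpqcTopology k)

instance enhancedPoints_isRightAdjoint (k : Type u) [Field k] :
    (enhancedPoints k).IsRightAdjoint :=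
  inferInstanceAs ((functions k).sheafPushforwardContinuous (Type (u + 1))
    (coherentTopology Profinite.{u}) (fpqcTopology k)).IsRightAdjoint

/-- The pétra space functor `f^*`, sending a condensed set `X` to the fpqc sheaf `X^pét_k`: the
left adjoint of the enhanced `k`-points functor. -/
noncomputable def petraSpace (k : Type u) [Field k] : Cond.{u} ⥤ FpqcSheaf k :=
  (enhancedPoints k).leftAdjoint

/-- The adjunction `f^* ⊣ f_*`. -/
noncomputable def petraAdjunction (k : Type u) [Field k] : petraSpace k ⊣ enhancedPoints k :=
  Adjunction.ofIsRightAdjoint (enhancedPoints k)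

/-- The underlying set `X(*)` of a condensed set `X`. -/
def underlyingSet : Cond.{u} ⥤ Type (u + 1) :=
  sheafToPresheaf _ _ ⋙ (evaluation _ _).obj (op (Profinite.of PUnit.{u + 1}))

/-- The set `𝒳(k)` of `k`-points of an fpqc sheaf `𝒳` over `k`. -/
def kPoints (k : Type u) [CommRing k] : FpqcSheaf k ⥤ Type (u + 1) :=
  sheafToPresheaf _ _ ⋙ (evaluation _ _).obj (op (op (CommAlgCat.of k k)))

/-- The map `f_*(𝒳)(*) = 𝒳(C(*, k)) ⟶ 𝒳(k)` induced by the evaluation `C(*, k) ≅ k`. -/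
noncomputable def enhancedPointsToPoints (k : Type u) [Field k] :
    enhancedPoints k ⋙ underlyingSet ⟶ kPoints k where
  app 𝒳 := 𝒳.obj.map (CommAlgCat.ofHom (LocallyConstant.evalₐ k PUnit.unit)).op.op
  naturality _ _ φ := (φ.hom.naturality _).symm

/-- The natural map `X(*) ⟶ f_*(f^*(X))(*) ⟶ X^pét_k(k)` induced by the unit `X ⟶ f_*(f^*(X))`. -/
noncomputable def pointMap (k : Type u) [Field k] :
    underlyingSet.{u} ⟶ petraSpace k ⋙ kPoints k :=
  Functor.whiskerRight (petraAdjunction k).unit underlyingSet ≫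
    Functor.whiskerLeft (petraSpace k) (enhancedPointsToPoints k)

end Petra

/-! The left adjoint `f^*` is made explicit. A `k`-algebra map `C(S, k) → B` amounts to a continuous
map `Spec B → S`, hence to a map `π₀(Spec B) → S` of profinite sets (`homFunctionsEquiv`,
`profiniteReflectionEquiv`). So `functions k` has a left adjoint `components k`, and `f^* X` is the
sheafification of the presheaf `P : B ↦ X(π₀(Spec B))`.

Since the spectrum of a field is a point, `P(k) = X(*)`, and `P(k) → P(L)` is bijective for every
field extension `L` of `k`. Every covering of `Spec k` is refined by such an `L`, which is itself a
covering, so sheafification does not change the value at `k` (`bijective_toSheafify_app_point`).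
Uniqueness of left adjoints carries the result over to `petraSpace k`. -/

namespace Petra

/-! ### Algebra maps out of `C(S, k)` as continuous maps out of spectra -/

section SpectralDescription

variable {k : Type u} [Field k] {B : Type u} [CommRing B] [Algebra k B]
  {Y : Type u} [TopologicalSpace Y] [CompactSpace Y] [T2Space Y] [TotallyDisconnectedSpace Y]

/-- One inclusion of ideals is enough: if the two points differed, the indicator of a clopen set
containing only `specPoint φ q` would violate it. -/
lemma specPoint_eq {φ : LocallyConstant Y k →ₐ[k] B} {q : PrimeSpectrum B} {y : Y}
    (h : ∀ f, f y = 0 → φ f ∈ q.asIdeal) : specPoint φ q = y := by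
  by_contra hne
  obtain ⟨U, hU, h1, h2⟩ := exists_isClopen_of_totally_separated hne
  have h3 := h (LocallyConstant.charFn k hU) ((LocallyConstant.charFn_eq_zero k y hU).2 h2)
  rw [mem_iff_specPoint, LocallyConstant.charFn_eq_zero] at h3
  exact h3 h1

end SpectralDescription

/-- Maps of `k`-algebras `C(S, k) → B` are the same as continuous maps `Spec B → S`. -/
noncomputable def homFunctionsEquiv {k : Type u} [Field k] (B : (CommAlgCat.{u} k)ᵒᵖ)
    (S : Profinite.{u}) :
    (B ⟶ (functions k).obj S) ≃ C(PrimeSpectrum B.unop, S) where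
  toFun f := ⟨specPoint (Y := S) f.unop.hom, continuous_specPoint (Y := S) f.unop.hom⟩
  invFun a := (CommAlgCat.ofHom (exists_algHom (k := k) a).choose).op
  left_inv f := by
    apply Quiver.Hom.unop_inj
    apply CommAlgCat.hom_ext
    refine AlgHom.ext fun l ↦ eq_of_stalks fun q ↦ ?_
    exact ((exists_algHom (k := k) _).choose_spec l q).trans
      (algebraMap_eq_specPoint (Y := S) f.unop.hom q l).symm
  right_inv a := by
    ext q
    refine specPoint_eq (Y := S) fun l hl ↦ ?_
    have h := (exists_algHom (k := k) a).choose_spec l q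
    -- The image of `l` vanishes in the local ring at `q`, so it is killed by an element outside `q`
    -- and therefore lies in `q`.
    rw [hl, map_zero, IsLocalization.map_eq_zero_iff q.asIdeal.primeCompl] at h
    obtain ⟨m, hm⟩ := h
    exact (q.2.mem_or_mem (hm ▸ q.asIdeal.zero_mem)).resolve_left m.2

lemma homFunctionsEquiv_comp {k : Type u} [Field k] {B : (CommAlgCat.{u} k)ᵒᵖ}
    {S T : Profinite.{u}} (f : B ⟶ (functions k).obj S) (g : S ⟶ T) :
    homFunctionsEquiv B T (f ≫ (functions k).map g) = g.hom.hom.comp (homFunctionsEquiv B S f) := by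
  ext q
  exact specPoint_eq (Y := T) fun l hl ↦
    (mem_iff_specPoint (Y := S) f.unop.hom q (l.comap g.hom.hom)).2 hl

/-! ### The left adjoint `π₀ ∘ Spec` of `functions k` -/

/-- Continuous maps from a space to a profinite set are the maps from its profinite reflection. -/
noncomputable def profiniteReflectionEquiv (X : TopCat.{u}) (S : Profinite.{u}) :
    (CompHaus.toProfinite.obj (topToCompHaus.obj X) ⟶ S) ≃ C(X, S) :=
  (Profinite.toCompHausEquivalence (topToCompHaus.obj X) S).trans
    ((stoneCechEquivalence X (profiniteToCompHaus.obj S)).trans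
      ⟨fun f ↦ f.hom, TopCat.ofHom, fun _ ↦ rfl, fun _ ↦ rfl⟩)

instance functions_isRightAdjoint (k : Type u) [Field k] : (functions k).IsRightAdjoint :=
  (Adjunction.adjunctionOfEquivLeft (G := functions k)
    (F_obj := fun B ↦ CompHaus.toProfinite.obj (topToCompHaus.obj
      (TopCat.of (PrimeSpectrum B.unop))))
    (fun B S ↦ (profiniteReflectionEquiv _ S).trans (homFunctionsEquiv B S).symm)
    fun B S T g h ↦ by
      simp only [Equiv.trans_apply]
      rw [Equiv.symm_apply_eq, homFunctionsEquiv_comp, Equiv.apply_symm_apply]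
      rfl).isRightAdjoint

/-- The profinite set of connected components of the spectrum of a `k`-algebra. -/
noncomputable def components (k : Type u) [Field k] :
    (CommAlgCat.{u} k)ᵒᵖ ⥤ Profinite.{u} :=
  (functions k).leftAdjoint

/-- The adjunction between connected components of spectra and algebras of functions. -/
noncomputable def componentsAdjunction (k : Type u) [Field k] : components k ⊣ functions k :=
  Adjunction.ofIsRightAdjoint (functions k)

/-- The spectrum of a field has a single connected component. -/
lemma isIso_components_of_isField {k : Type u} [Field k] {B : (CommAlgCat.{u} k)ᵒᵖ}
    (hB : IsField B.unop) (t : (components k).obj B ⟶ Profinite.of PUnit.{u + 1}) : IsIso t := by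
  let := hB.toField
  have hsub : Subsingleton (PrimeSpectrum B.unop) :=
    inferInstanceAs (Subsingleton (PrimeSpectrum B.unop))
  let b : PrimeSpectrum B.unop := ⊥
  let adj := componentsAdjunction k
  let a := homFunctionsEquiv B _ (adj.homEquiv B _ (𝟙 _))
  let s : Profinite.of PUnit.{u + 1} ⟶ (components k).obj B :=
    CompHausLike.ofHom _ ⟨fun _ ↦ a b, continuous_const⟩
  refine ⟨s, ?_, rfl⟩
  -- Endomorphisms of `(components k).obj B` transpose to maps out of `Spec B`, so agreement at its
  -- only prime suffices.
  apply (adj.homEquiv B _).injective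
  apply (homFunctionsEquiv B _).injective
  rw [Adjunction.homEquiv_naturality_right, homFunctionsEquiv_comp]
  ext q
  rw [Subsingleton.elim q b]
  rfl

/-! ### Sheafification does not change the value at `k` -/

section Sheafification

variable {k : Type u} [Field k]

/-- A covering sieve of the point contains a field extension of `k`. -/
lemma exists_field_of_mem_fpqcTopology {S : Sieve (op (CommAlgCat.of k k))}
    (hS : S ∈ fpqcTopology k (op (CommAlgCat.of k k))) :
    ∃ (L : (CommAlgCat.{u} k)ᵒᵖ) (f : L ⟶ op (CommAlgCat.of k k)), IsField L.unop ∧ S f := by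
  obtain ⟨ι, hι, B, f, hf, hS⟩ := hS
  obtain ⟨i, q, -⟩ := hf.surj (⊥ : PrimeSpectrum k)
  -- The prime `q` over the point of `Spec k` shows `B i ≠ 0`; the quotient by a maximal ideal is
  -- the desired extension.
  obtain ⟨m, hm, -⟩ := Ideal.exists_le_maximal q.asIdeal q.2.ne_top
  let π : B i ⟶ CommAlgCat.of k (B i ⧸ m) := CommAlgCat.ofHom (Ideal.Quotient.mkₐ k m)
  exact ⟨op (CommAlgCat.of k (B i ⧸ m)), π.op ≫ (f i).op,
    (Ideal.Quotient.maximal_ideal_iff_isField_quotient m).1 hm, S.downward_closed (hS i) _⟩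

/-- Every field extension of `k` is an fpqc covering. -/
lemma generate_singleton_mem_fpqcTopology {L : (CommAlgCat.{u} k)ᵒᵖ}
    (f : L ⟶ op (CommAlgCat.of k k)) (hL : IsField L.unop) :
    Sieve.generate (Presieve.singleton f) ∈ fpqcTopology k (op (CommAlgCat.of k k)) := by
  let := hL.toField
  refine ⟨Unit, inferInstance, fun _ ↦ L.unop, fun _ ↦ f.unop, ⟨fun _ ↦ ?_, fun p ↦ ?_⟩,
    fun _ ↦ ⟨L, 𝟙 L, f, Presieve.singleton_self f, Category.id_comp f⟩⟩
  · let : Module k L.unop := f.unop.hom.toRingHom.toModule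
    exact Module.Flat.of_free (R := k) (M := L.unop)
  · exact ⟨(), (⊥ : PrimeSpectrum L.unop),
      @Subsingleton.elim _ (inferInstanceAs (Subsingleton (PrimeSpectrum k))) _ _⟩

/-- A presheaf which takes the same values at `k` and at field extensions of `k` has the same
`k`-points as its sheafification. -/
lemma bijective_toSheafify_app_point (P : (CommAlgCat.{u} k)ᵒᵖᵒᵖ ⥤ Type (u + 1))
    (hP : ∀ (L : (CommAlgCat.{u} k)ᵒᵖ) (f : L ⟶ op (CommAlgCat.of k k)), IsField L.unop →
      Function.Bijective (P.map f.op)) :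
    Function.Bijective ((toSheafify (fpqcTopology k) P).app (op (op (CommAlgCat.of k k)))) := by
  have : Presheaf.IsLocallyInjective (fpqcTopology k) (toSheafify (fpqcTopology k) P) :=
    Presheaf.isLocallyInjective_toSheafify' _ _
  have : Presheaf.IsLocallySurjective (fpqcTopology k) (toSheafify (fpqcTopology k) P) :=
    Presheaf.isLocallySurjective_toSheafify' _ _
  constructor
  · intro x y hxy
    obtain ⟨L, f, hL, hf⟩ := exists_field_of_mem_fpqcTopology
      (Presheaf.equalizerSieve_mem (fpqcTopology k) (toSheafify (fpqcTopology k) P) x y hxy)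
    exact (hP L f hL).1 hf
  · intro s
    obtain ⟨L, f, hL, p, hp⟩ := exists_field_of_mem_fpqcTopology
      -- Over some field extension `L` the section `s` comes from `P(L)`, hence from `P(k)`;
      -- separatedness for the covering `L` then identifies the two sections over `k`.
      (Presheaf.imageSieve_mem (fpqcTopology k) (toSheafify (fpqcTopology k) P) s)
    obtain ⟨x, rfl⟩ := (hP L f hL).2 p
    refine ⟨x, ?_⟩
    have hF := (isSheaf_iff_isSheaf_of_type _ _).1 
      ((presheafToSheaf (fpqcTopology k) (Type (u + 1))).obj P).property
    refine (hF _ (generate_singleton_mem_fpqcTopology f hL)).isSeparatedFor.ext ?_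
    rintro M _ ⟨N, g, _, ⟨⟩, rfl⟩
    have h : (sheafify (fpqcTopology k) P).map f.op
        ((toSheafify (fpqcTopology k) P).app (op (op (CommAlgCat.of k k))) x) =
        (sheafify (fpqcTopology k) P).map f.op s :=
      (NatTrans.naturality_apply (toSheafify (fpqcTopology k) P) f.op x).symm.trans hp
    simp [h]

end Sheafification

/-! ### An explicit model of `f^*` and its unit -/

/-- The pétra space functor as the sheafification of `B ↦ X(π₀(Spec B))`. -/
noncomputable def componentsSheaf (k : Type u) [Field k] : Cond.{u} ⥤ FpqcSheaf k :=
  sheafToPresheaf _ _ ⋙ (Functor.whiskeringLeft _ _ _).obj (components k).op ⋙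
    presheafToSheaf (fpqcTopology k) (Type (u + 1))

/-- Sheafified pullback along connected components is left adjoint to enhanced points. -/
noncomputable def componentsSheafAdjunction (k : Type u) [Field k] :
    componentsSheaf k ⊣ enhancedPoints k :=
  -- On presheaves, precomposition with `components k` is left adjoint to precomposition with
  -- `functions k`; sheafification then corrects the target.
  (((componentsAdjunction k).op.whiskerLeft (Type (u + 1))).comp
    (sheafificationAdjunction (fpqcTopology k) (Type (u + 1)))).restrictFullyFaithful
      (fullyFaithfulSheafToPresheaf _ _) (Functor.FullyFaithful.id _)
      (Iso.refl _) (Iso.refl _)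

lemma componentsSheafAdjunction_unit_app (k : Type u) [Field k] (X : Cond.{u})
    (S : Profinite.{u}) :
    ((componentsSheafAdjunction k).unit.app X).hom.app (op S) =
      X.obj.map ((componentsAdjunction k).counit.app S).op ≫
        (toSheafify (fpqcTopology k) ((components k).op ⋙ X.obj)).app
          (op ((functions k).obj S)) := by
  have h := (((componentsAdjunction k).op.whiskerLeft (Type (u + 1))).comp
    (sheafificationAdjunction (fpqcTopology k)
      (Type (u + 1)))).map_restrictFullyFaithful_unit_app
      (fullyFaithfulSheafToPresheaf _ _) (Functor.FullyFaithful.id _)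
      (L := componentsSheaf k) (R := enhancedPoints k) (Iso.refl _) (Iso.refl _) X
  exact congrArg (fun α ↦ NatTrans.app α (op S)) h

/-- By naturality of `toSheafify`, the composite is `X` applied to `π₀(Spec k) → *`, followed by
`P(k) → P⁺(k)`, where `P⁺` is the sheafification; both are bijective. -/
lemma isIso_componentsSheaf_pointMap (k : Type u) [Field k] (X : Cond.{u}) :
    IsIso (underlyingSet.map ((componentsSheafAdjunction k).unit.app X) ≫
      (enhancedPointsToPoints k).app ((componentsSheaf k).obj X)) := by
  let P := (components k).op ⋙ X.obj
  let ev : op (CommAlgCat.of k k) ⟶ (functions k).obj (Profinite.of PUnit.{u + 1}) :=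
    (CommAlgCat.ofHom (LocallyConstant.evalₐ k PUnit.unit)).op
  have h : underlyingSet.map ((componentsSheafAdjunction k).unit.app X) ≫
      (enhancedPointsToPoints k).app ((componentsSheaf k).obj X) =
      X.obj.map ((components k).map ev ≫ (componentsAdjunction k).counit.app _).op ≫
        (toSheafify (fpqcTopology k) P).app (op (op (CommAlgCat.of k k))) := by
    change ((componentsSheafAdjunction k).unit.app X).hom.app _ ≫
      (sheafify (fpqcTopology k) P).map ev.op = _
    rw [componentsSheafAdjunction_unit_app, op_comp, Functor.map_comp]
    exact congrArg (X.obj.map ((componentsAdjunction k).counit.app _).op ≫ ·)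
      ((toSheafify (fpqcTopology k) P).naturality ev.op).symm
  rw [h]
  have h1 : IsIso ((components k).map ev ≫ (componentsAdjunction k).counit.app _) :=
    isIso_components_of_isField (Field.toIsField k) _
  have h2 : IsIso ((toSheafify (fpqcTopology k) P).app (op (op (CommAlgCat.of k k)))) := by
    rw [isIso_iff_bijective]
    refine bijective_toSheafify_app_point P fun L f hL ↦ ?_
    -- Both `π₀(Spec L)` and `π₀(Spec k)` map isomorphically to the point, hence so does the first
    -- to the second.
    have h3 := isIso_components_of_isField hL
      ((components k).map f ≫ (components k).map ev ≫ (componentsAdjunction k).counit.app _)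
    have h4 : IsIso ((components k).map f) := IsIso.of_isIso_comp_right _
      ((components k).map ev ≫ (componentsAdjunction k).counit.app _)
    rw [← isIso_iff_bijective]
    exact inferInstanceAs (IsIso (X.obj.map ((components k).map f).op))
  exact IsIso.comp_isIso' (Functor.map_isIso X.obj (Quiver.Hom.op _)) h2

end Petra

theorem mainTheorem8 (k : Type u) [Field k] :
    ∃ e : Petra.underlyingSet.{u} ≅ Petra.petraSpace k ⋙ Petra.kPoints k,
      e.hom = Petra.pointMap k := by
  have (X : Petra.Cond.{u}) : IsIso ((Petra.pointMap k).app X) := by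
    let e := ((Petra.componentsSheafAdjunction k).leftAdjointUniq (Petra.petraAdjunction k)).app X
    have h : (Petra.pointMap k).app X =
        (Petra.underlyingSet.map ((Petra.componentsSheafAdjunction k).unit.app X) ≫
          (Petra.enhancedPointsToPoints k).app ((Petra.componentsSheaf k).obj X)) ≫
          (Petra.kPoints k).map e.hom := by
      rw [Category.assoc, ← NatTrans.naturality, Functor.comp_map, ← Category.assoc,
        ← Functor.map_comp]
      -- What remains is that the comparison of left adjoints matches the two units.
      refine congrArg (fun f : X ⟶ (Petra.enhancedPoints k).obj ((Petra.petraSpace k).obj X) ↦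
        Petra.underlyingSet.map f ≫
        (Petra.enhancedPointsToPoints k).app ((Petra.petraSpace k).obj X)) ?_
      exact (Adjunction.unit_leftAdjointUniq_hom_app _ _ X).symm
    rw [h]
    have := Petra.isIso_componentsSheaf_pointMap k X
    infer_instance
  have := NatIso.isIso_of_isIso_app (Petra.pointMap k)
  exact ⟨asIso (Petra.pointMap k), rfl⟩
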